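/- **Setting.** Let $n\ge 2$ and let $\overline r, M,\widetilde\delta, L>0$ and $0<\alpha<1$ be given. For an open set $U\subset\mathbb R^n$, say that $\partial U$ is *of class $C^{1,\alpha}$ with constants $\overline r, L$* if for every $P\in\partial U$ there is a rigid transformation of coordinates under which $P=0$ and $$U\cap B_{\overline r}(0)=\{x=(x',x_n)\in B_{\overline r}(0): x_n>\varphi(x')\},$$ where $\varphi$ is a $C^{1,\alpha}$ function on $B_{\overline r}(0)\subset\mathbb R^{n-1}$ with $\varphi(0)=|\nabla\varphi(0)|=0$ and $$\|\varphi\|_{L^\infty(B_{\overline r}(0))}+\overline r\,\|\nabla\varphi\|_{L^\infty(B_{\overline r}(0))}+\overline r^{\,1+\alpha}\sup_{x'\ne y'\in B_{\overline r}(0)}\frac{|\nabla\varphi(x')-\nabla\varphi(y')|}{|x'-y'|^{\alpha}}\le L\overline r .$$ (H1) $\Omega\subset\mathbb R^n$ is a bounded domain (nonempty, open, connected) with $|\Omega|\le M\overline r^{\,n}$ and with $\partial\Omega$ of class $C^{1,\alpha}$ with constants $\overline r, L$. (H2) $D\subset\Omega$ is a nonempty bounded open set (not necessarily connected) such that $\Omega\setminus\overline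 D$ is connected, $\mathrm{dist}(D,\partial\Omega)\ge\widetilde\delta$, and $\partial D$ is of class $C^{1,\alpha}$ with constants $\overline r, L$. Given $\Omega$ satisfying (H1) and $D_1,D_2$ satisfying (H2), let $\mathcal G$ be the connected component of $\Omega\setminus(D_1\cup D_2)$ whose boundary contains $\partial\Omega$ (it is assumed that there is such a component, as is the case whenever $\partial\Omega$ is connected), let $\Omega_D=\Omega\setminus\overline{\mathcal G}$, and define the modified distance $$d_\mu(D_1,D_2)=\max\Big\{\sup_{x\in\partial D_1\cap\partial\Omega_D}\mathrm{dist}(x,D_2),\ \sup_{x\in\partial D_2\cap\partial\Omega_D}\mathrm{dist}(x,D_1)\Big\},$$ where the supremum over the empty set is $0$. Let $d_{\mathcal H}$ denote the Hausdorff distance. **Proposition 3.1.** There is a constant $c>0$ depending only on $n,\overline r,M,\widetilde\delta,L,\alpha$ such that, for every $\Omega$ satisfying (H1) and all $D_1,D_2$ satisfying (H2) for which $\mathcal G$ exists, $$d_{\mathcal H}(\partial D_1,\partial D_2)\le c\,d_\mu(D_1,D_2).$$ -/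

import Mathlib

open MeasureTheory
open scoped ENNReal

noncomputable section

/-- The `α`-Hölder seminorm of `f` on `s`, as an extended nonnegative number (for `α > 0` the
diagonal contributes `0 / 0 = 0`). -/
def holderSeminormOn {E F : Type*} [NormedAddCommGroup E] [NormedAddCommGroup F]
    (α : ℝ) (f : E → F) (s : Set E) : ℝ≥0∞ :=
  ⨆ x ∈ s, ⨆ y ∈ s, ‖f x - f y‖ₑ / ‖x - y‖ₑ ^ α

/-- The scaled norm
`‖φ‖_{C^{1,α}(B_r(0))} = sup |φ| + r sup |∇φ| + r^{1+α} [∇φ]_α`, all on the open ball `B_r(0)`.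
The derivative `fderiv ℝ φ` with its operator norm stands for the gradient with its
Euclidean norm. -/
def scaledC1Norm {E : Type*} [NormedAddCommGroup E] [NormedSpace ℝ E]
    (r α : ℝ) (φ : E → ℝ) : ℝ≥0∞ :=
  (⨆ x ∈ Metric.ball (0 : E) r, ‖φ x‖ₑ)
    + ENNReal.ofReal r * (⨆ x ∈ Metric.ball (0 : E) r, ‖fderiv ℝ φ x‖ₑ)
    + ENNReal.ofReal (r ^ (1 + α)) * holderSeminormOn α (fderiv ℝ φ) (Metric.ball (0 : E) r)

/-- The boundary of `U ⊆ ℝⁿ` is of class `C^{1,α}` with constants `r`, `L`: around each boundary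
point `P` there are rigid coordinates `e x = (x', xₙ) ∈ ℝⁿ⁻¹ × ℝ` (with the Euclidean norm)
that send `P` to `0` and in which `U ∩ B_r(P)` is the part of the ball above the graph
of `φ`. -/
def HasC1AlphaBoundary {n : ℕ} (r L α : ℝ) (U : Set (EuclideanSpace ℝ (Fin n))) : Prop :=
  ∀ P ∈ frontier U,
    ∃ (e : EuclideanSpace ℝ (Fin n) ≃ᵃⁱ[ℝ] WithLp 2 (EuclideanSpace ℝ (Fin (n - 1)) × ℝ))
      (φ : EuclideanSpace ℝ (Fin (n - 1)) → ℝ),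
      e P = 0 ∧
      U ∩ Metric.ball P r = {x ∈ Metric.ball P r | φ (e x).fst < (e x).snd} ∧
      ContDiffOn ℝ 1 φ (Metric.ball 0 r) ∧
      φ 0 = 0 ∧ fderiv ℝ φ 0 = 0 ∧
      scaledC1Norm r α φ ≤ ENNReal.ofReal (L * r)

/-- The conditions on the conductor: `Ω` is a bounded domain of Lebesgue measure at most `M rⁿ`
with boundary of class `C^{1,α}` with constants `r`, `L`. -/
structure IsConductor {n : ℕ} (r M L α : ℝ) (Ω : Set (EuclideanSpace ℝ (Fin n))) : Prop where
  isOpen : IsOpen Ω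
  isConnected : IsConnected Ω
  isBounded : Bornology.IsBounded Ω
  volume_le : volume Ω ≤ ENNReal.ofReal (M * r ^ n)
  boundary : HasC1AlphaBoundary r L α Ω

/-- The conditions on an inclusion: `D` is a nonempty bounded open subset of `Ω` (possibly
disconnected), `Ω \ closure D` is connected, `dist(D, ∂Ω) ≥ δ`, and the boundary of `D` is of
class `C^{1,α}` with constants `r`, `L`. -/
structure IsInclusion {n : ℕ} (r δ L α : ℝ) (Ω D : Set (EuclideanSpace ℝ (Fin n))) : Prop where
  nonempty : D.Nonempty
  isOpen : IsOpen D
  isBounded : Bornology.IsBounded D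
  subset : D ⊆ Ω
  isConnected_diff : IsConnected (Ω \ closure D)
  le_dist : ∀ x ∈ D, ∀ y ∈ frontier Ω, δ ≤ dist x y
  boundary : HasC1AlphaBoundary r L α D

/-- `G` is the connected component of `Ω \ (D₁ ∪ D₂)` whose boundary contains `∂Ω`. -/
def IsOuterComponent {n : ℕ} (Ω D₁ D₂ G : Set (EuclideanSpace ℝ (Fin n))) : Prop :=
  (∃ x ∈ Ω \ (D₁ ∪ D₂), G = connectedComponentIn (Ω \ (D₁ ∪ D₂)) x) ∧
    frontier Ω ⊆ frontier G

/-- The modified distance of `D₁` and `D₂`, where `G` is the component of `Ω \ (D₁ ∪ D₂)` whose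
boundary contains `∂Ω`. With `Ω_D = Ω \ closure G` it is the larger of the supremum of
`dist(x, D₂)` over `∂D₁ ∩ ∂Ω_D` and the supremum of `dist(x, D₁)` over `∂D₂ ∩ ∂Ω_D`; a supremum
over the empty set is `0`. -/
def modifiedDist {n : ℕ} (Ω G D₁ D₂ : Set (EuclideanSpace ℝ (Fin n))) : ℝ≥0∞ :=
  max (⨆ x ∈ frontier D₁ ∩ frontier (Ω \ closure G), Metric.infEDist x D₂)
    (⨆ x ∈ frontier D₂ ∩ frontier (Ω \ closure G), Metric.infEDist x D₁)

end

/-! Only the Lipschitz bound on the graphs matters: it gives `D₁`, `D₂`, their complements and `Ω`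
cones of opening η = 1/(1+L) at a uniform scale. The admissible directions at a point form a convex
set, so a partition of unity glues them into a continuous field `f`. The map x ↦ x + (h/2) f(x)
carries the connected set Ω \ closure D to a connected set at distance at least ηh/2 from `D` and
fixes the points near ∂Ω (`UniformCone.exists_isPreconnected`).

Hence a point of `Ω` at distance h from `D₂` and not interior to `G` is joined to `G` by a connected
set keeping ηh/2 away from `D₂`. That set crosses ∂G, necessarily at a point of ∂D₁ ∩ ∂Ω_D, so d_μ ≥
ηh/2 (`IsOuterComponent.le_modifiedDist`). A point of ∂D₁ at small distance h from ∂D₂ either is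
such a point or lies in `D₂`; in the second case it is first pushed away from `D₁` and the roles are
exchanged. Large distances are absorbed by a bound on the diameter of `Ω`, which comes from its
volume. -/

theorem IsPreconnected.subset_interior_of_disjoint_frontier {X : Type*} [TopologicalSpace X]
    {T A : Set X} (hT : IsPreconnected T) {a : X} (haT : a ∈ T) (haA : a ∈ A)
    (h : Disjoint T (frontier A)) : T ⊆ interior A := by
  have key : ∀ x ∈ T, x ∉ interior A → x ∈ interior Aᶜ := by
    intro x hx hi
    rw [interior_compl]
    exact fun hc => h.le_bot ⟨hx, hc, hi⟩
  refine hT.subset_left_of_subset_union isOpen_interior (isOpen_interior (s := Aᶜ)) ?_ ?_ ?_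
  · rw [interior_compl]
    exact Set.disjoint_left.2 fun x hx hx' => hx' (subset_closure (interior_subset hx))
  · intro x hx
    by_cases hi : x ∈ interior A
    · exact Or.inl hi
    · exact Or.inr (key x hx hi)
  · refine ⟨a, haT, ?_⟩
    by_contra hi
    exact interior_subset (key a haT hi) haA

/-! ### Cone conditions and continuous push fields. -/

section Cone

variable {E : Type*} [NormedAddCommGroup E] [NormedSpace ℝ E]

/-- Uniform interior cone condition: near each boundary point there is a direction `ν` such that
the cones of opening `η` around `ν` with vertex in `V` stay in `V`, within a ball of radius `r`. -/
def UniformCone (V : Set E) (r η : ℝ) : Prop :=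
  ∀ P ∈ frontier V, ∃ ν : E, ‖ν‖ ≤ 1 ∧ ∀ z ∈ V ∩ Metric.ball P r, ∀ t : ℝ, 0 ≤ t → ∀ u : E,
    ‖u‖ ≤ η * t → z + t • ν + u ∈ Metric.ball P r → z + t • ν + u ∈ V

/-- Reversing the axis works: if a step along -ν from outside `V` landed in `V`, the opposite step
along ν would bring the starting point into `V`. -/
theorem UniformCone.compl {V : Set E} {r η : ℝ} (h : UniformCone V r η) :
    UniformCone Vᶜ r η := by
  intro P hP
  rw [frontier_compl] at hP
  obtain ⟨ν, hν, hc⟩ := h P hP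
  refine ⟨-ν, by rwa [norm_neg], ?_⟩
  rintro z ⟨hzV, hzP⟩ t ht u hu hb hV
  have e : z + t • -ν + u + t • ν + -u = z := by rw [smul_neg]; abel
  refine hzV ?_
  have := hc _ ⟨hV, hb⟩ t ht (-u) (by rwa [norm_neg])
  rw [e] at this
  exact this hzP

theorem UniformCone.mono {V : Set E} {r r' η : ℝ} (h : UniformCone V r η) (hr : r' ≤ r) :
    UniformCone V r' η := by
  intro P hP
  obtain ⟨ν, hν, hc⟩ := h P hP
  exact ⟨ν, hν, fun z hz t ht u hu hb => hc z ⟨hz.1, Metric.ball_subset_ball hr hz.2⟩ t ht u hu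
    (Metric.ball_subset_ball hr hb)⟩

/-- Directions in which `V` can be pushed into itself, with cones of opening `η`, near `x`. -/
def pushDirections (V : Set E) (ρ η : ℝ) (x : E) : Set E :=
  {v | ‖v‖ ≤ 1 ∧ ∀ z ∈ V, ∀ t : ℝ, 0 ≤ t → ∀ u : E, ‖u‖ ≤ η * t → dist z x + 2 * t < ρ →
    z + t • v + u ∈ V}

/-- A push along a•v + b•w is a push along v for time ta followed by one along w for time tb. This
is why the definition allows every nearby starting point `z`, and why its budget is `dist z x + 2 *
t`: a push of time t moves by at most (1+η)t ≤ 2t, so the first leg leaves enough for the second. -/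
theorem convex_pushDirections (V : Set E) (ρ : ℝ) {η : ℝ} (hη : η ≤ 1) (x : E) :
    Convex ℝ (pushDirections V ρ η x) := by
  rintro v ⟨hv, hcv⟩ w ⟨hw, hcw⟩ a b ha hb hab
  refine ⟨?_, ?_⟩
  · have := convex_closedBall (0 : E) 1 (mem_closedBall_zero_iff.2 hv)
      (mem_closedBall_zero_iff.2 hw) ha hb hab
    exact mem_closedBall_zero_iff.1 this
  · intro z hz t ht u hu hd
    have hau : ‖a • u‖ ≤ η * (t * a) := by
      rw [norm_smul, Real.norm_of_nonneg ha]; nlinarith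
    have hbu : ‖b • u‖ ≤ η * (t * b) := by
      rw [norm_smul, Real.norm_of_nonneg hb]; nlinarith
    have hta : 0 ≤ t * a := mul_nonneg ht ha
    have htb : 0 ≤ t * b := mul_nonneg ht hb
    have htt : t * a + t * b = t := by rw [← mul_add, hab, mul_one]
    have h1 := hcv z hz (t * a) hta (a • u) hau (by linarith)
    have hd1 : dist (z + (t * a) • v + a • u) x ≤ dist z x + 2 * (t * a) := by
      have h2 : dist (z + (t * a) • v + a • u) z ≤ 2 * (t * a) := by
        rw [dist_eq_norm, show z + (t * a) • v + a • u - z = (t * a) • v + a • u by abel]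
        refine (norm_add_le _ _).trans ?_
        rw [norm_smul (t * a) v, Real.norm_of_nonneg hta]
        nlinarith
      linarith [dist_triangle (z + (t * a) • v + a • u) z x]
    have h2 := hcw _ h1 (t * b) htb (b • u) hbu (by linarith)
    have e : z + (t * a) • v + a • u + (t * b) • w + b • u = z + t • (a • v + b • w) + u := by
      have : u = a • u + b • u := by rw [← add_smul, hab, one_smul]
      conv_rhs => rw [this]
      rw [smul_add, smul_smul, smul_smul]
      abel
    rwa [e] at h2

theorem closedBall_subset_of_mem_pushDirections {V : Set E} {ρ η : ℝ} {x v : E}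
    (hv : v ∈ pushDirections V ρ η x) (hx : x ∈ V) {s : ℝ} (hs : 0 ≤ s) (hsρ : 2 * s < ρ) :
    Metric.closedBall (x + s • v) (η * s) ⊆ V := by
  intro y hy
  have := hv.2 x hx s hs (y - (x + s • v)) (by rwa [← dist_eq_norm]) (by rwa [dist_self, zero_add])
  rwa [add_sub_cancel] at this

theorem zero_mem_pushDirections {V : Set E} {ρ η : ℝ} (hη : η ≤ 1) {x : E}
    (h : ∀ P ∈ frontier V, ρ ≤ dist x P) : (0 : E) ∈ pushDirections V ρ η x := by
  refine ⟨by simp, fun z hz t ht u hu hd => ?_⟩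
  have hzx : z ∈ Metric.ball x ρ := by rw [Metric.mem_ball]; linarith
  have hs := (convex_ball x ρ).isPreconnected.subset_interior_of_disjoint_frontier hzx hz
    (Set.disjoint_left.2 fun P hP hP' => by
      have := h P hP'
      rw [Metric.mem_ball, dist_comm] at hP
      linarith)
  refine interior_subset (hs ?_)
  have e : dist (z + t • (0 : E) + u) z = ‖u‖ := by simp [dist_eq_norm]
  have := dist_triangle (z + t • (0 : E) + u) z x
  rw [Metric.mem_ball]
  nlinarith

/-- A continuous vector field of push directions that vanishes away from the boundary. -/
theorem UniformCone.exists_continuous_pushDirections {V : Set E} {r η : ℝ}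
    (h : UniformCone V r η) (hr : 0 < r) (hη : η ≤ 1) :
    ∃ f : C(E, E), ∀ x, f x ∈ pushDirections V (r / 4) η x ∧
      ((∀ P ∈ frontier V, r / 2 ≤ dist x P) → f x = 0) := by
  refine exists_continuous_forall_mem_convex_of_local_const
    (t := fun x => {v | v ∈ pushDirections V (r / 4) η x ∧
      ((∀ P ∈ frontier V, r / 2 ≤ dist x P) → v = 0)}) ?_ ?_
  · rintro x v ⟨hv, hv0⟩ w ⟨hw, hw0⟩ a b ha hb hab
    exact ⟨convex_pushDirections V _ hη x hv hw ha hb hab,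
      fun hx => by rw [hv0 hx, hw0 hx]; simp⟩
  · intro x
    -- Within r/2 of the boundary the cone axis at `P` serves on a neighbourhood, as r/2 + r/4 < r.
    -- Elsewhere the zero vector does, since points within r/4 of `x` are still r/4 away from the
    -- boundary.
    by_cases hx : ∃ P ∈ frontier V, dist x P < r / 2
    · obtain ⟨P, hP, hxP⟩ := hx
      obtain ⟨ν, hν, hc⟩ := h P hP
      refine ⟨ν, ?_⟩
      filter_upwards [Metric.isOpen_ball.mem_nhds (show x ∈ Metric.ball P (r / 2) from hxP)]
        with y hy
      rw [Metric.mem_ball] at hy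
      refine ⟨⟨hν, fun z hz t ht u hu hd => ?_⟩, fun hfar => absurd (hfar P hP) (by linarith)⟩
      have h1 : dist z P ≤ dist z y + dist y P := dist_triangle _ _ _
      refine hc z ⟨hz, ?_⟩ t ht u hu ?_
      · rw [Metric.mem_ball]; linarith
      · have h2 : dist (z + t • ν + u) z ≤ 2 * t := by
          rw [dist_eq_norm, show z + t • ν + u - z = t • ν + u by abel]
          refine (norm_add_le _ _).trans ?_
          rw [norm_smul, Real.norm_of_nonneg ht]
          nlinarith
        have := dist_triangle (z + t • ν + u) z P
        rw [Metric.mem_ball]; linarith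
    · push Not at hx
      refine ⟨0, ?_⟩
      filter_upwards [Metric.ball_mem_nhds x (show 0 < r / 4 by linarith)] with y hy
      rw [Metric.mem_ball, dist_comm] at hy
      refine ⟨zero_mem_pushDirections hη fun P hP => ?_, fun _ => rfl⟩
      have := dist_triangle x y P
      linarith [hx P hP]

theorem dist_add_smul_le {x v : E} (hv : ‖v‖ ≤ 1) {s : ℝ} (hs : 0 ≤ s) :
    dist (x + s • v) x ≤ s := by
  rw [dist_eq_norm, add_sub_cancel_left, norm_smul, Real.norm_of_nonneg hs]
  nlinarith

/-- Quantitative connectedness of `Ω \ closure D`. -/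
theorem UniformCone.exists_isPreconnected {Ω D : Set E} {r η δ h : ℝ}
    (hcone : UniformCone Dᶜ r η) (hη : η ≤ 1) (hr : 0 < r) (hrδ : r ≤ δ)
    (hconn : IsPreconnected (Ω \ closure D))
    (hdist : ∀ x ∈ D, ∀ y ∈ frontier Ω, δ ≤ dist x y) (hh₀ : 0 < h) (hh : h < r / 4)
    {y g : E} (hy : y ∈ Ω) (hyD : ∀ w ∈ D, h ≤ dist y w) (hg : g ∈ Ω \ closure D)
    (hgΩ : ∃ Q ∈ frontier Ω, dist g Q < δ / 2) :
    ∃ S : Set E, IsPreconnected S ∧ y ∈ S ∧ g ∈ S ∧ S ⊆ Ω ∧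
      ∀ z ∈ S, ∀ w ∈ D, η * (h / 2) ≤ dist z w := by
  have hyc : y ∉ closure D := by
    intro hc
    obtain ⟨w, hw, hd⟩ := Metric.mem_closure_iff.1 hc h hh₀
    linarith [hyD w hw]
  have hdist' : ∀ x ∈ frontier D, ∀ y ∈ frontier Ω, δ ≤ dist x y := by
    intro x hx y hy
    by_contra! hlt
    obtain ⟨w, hw, hd⟩ := Metric.mem_closure_iff.1 hx.1 (δ - dist x y) (by linarith)
    have := dist_triangle_left w y x
    linarith [hdist w hw y hy]
  obtain ⟨f, hf⟩ := hcone.exists_continuous_pushDirections hr hη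
  rw [frontier_compl] at hf
  -- The field acts only within r/2 of ∂D, hence at least δ - r/2 ≥ r/2 from ∂Ω, and displacements
  -- are below r/8.
  have hΩ : ∀ x ∈ Ω, ∀ s, 0 ≤ s → s ≤ h / 2 → x + s • f x ∈ Ω := by
    intro x hx s hs hsh
    by_cases hfar : ∀ P ∈ frontier D, r / 2 ≤ dist x P
    · rwa [(hf x).2 hfar, smul_zero, add_zero]
    · push Not at hfar
      obtain ⟨P, hP, hxP⟩ := hfar
      have hsub := (convex_ball x (r / 4)).isPreconnected.subset_interior_of_disjoint_frontier
        (Metric.mem_ball_self (by linarith)) hx (Set.disjoint_left.2 fun Q hQ hQ' => by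
          have h1 := hdist' P hP Q hQ'
          have h2 := dist_triangle P x Q
          rw [Metric.mem_ball, dist_comm] at hQ
          rw [dist_comm] at hxP
          linarith)
      refine interior_subset (hsub ?_)
      rw [Metric.mem_ball]
      linarith [dist_add_smul_le (x := x) (hf x).1.1 hs]
  have hh2 : 0 ≤ h / 2 := by linarith
  let F : E → E := fun x => x + (h / 2) • f x
  have hF : Continuous F := by fun_prop
  let p : ℝ → E := fun s => y + s • f y
  have hp : Continuous p := by fun_prop
  have hyW : y ∈ Ω \ closure D := ⟨hy, hyc⟩
  -- The segment reattaches `y` to its image `F y`; it loses at most h/2 of the distance h from `D`.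
  refine ⟨F '' (Ω \ closure D) ∪ p '' Set.Icc 0 (h / 2),
    (hconn.image F hF.continuousOn).union (F y) (Set.mem_image_of_mem _ hyW)
      ⟨h / 2, ⟨hh2, le_rfl⟩, rfl⟩ (isPreconnected_Icc.image p hp.continuousOn),
    Or.inr ⟨0, ⟨le_rfl, hh2⟩, by simp [p]⟩, Or.inl ⟨g, hg, ?_⟩, ?_, ?_⟩
  · have : f g = 0 := (hf g).2 fun P hP => by
      obtain ⟨Q, hQ, hgQ⟩ := hgΩ
      have h1 := hdist' P hP Q hQ
      have h2 := dist_triangle_left P Q g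
      linarith
    simp [F, this]
  · rintro _ (⟨x, hx, rfl⟩ | ⟨s, hs, rfl⟩)
    · exact hΩ x hx.1 _ hh2 le_rfl
    · exact hΩ y hy s hs.1 hs.2
  · rintro _ (⟨x, hx, rfl⟩ | ⟨s, hs, rfl⟩) w hw
    · by_contra! hlt
      refine closedBall_subset_of_mem_pushDirections (hf x).1
        (fun hxD => hx.2 (subset_closure hxD)) hh2 (by linarith) ?_ hw
      rw [Metric.mem_closedBall, dist_comm]
      exact hlt.le
    · have h1 := dist_add_smul_le (x := y) (hf y).1.1 hs.1
      have h2 := dist_triangle_left y w (y + s • f y)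
      have h3 := hyD w hw
      have h4 := hs.2
      change _ ≤ dist (y + s • f y) w
      nlinarith

end Cone

/-! ### From boundary regularity to cones, and the diameter bound. -/

theorem HasC1AlphaBoundary.uniformCone {n : ℕ} {r L α : ℝ} {U : Set (EuclideanSpace ℝ (Fin n))}
    (h : HasC1AlphaBoundary r L α U) (hr : 0 < r) (hL : 0 < L) :
    UniformCone U r (1 / (1 + L)) := by
  intro P hP
  obtain ⟨e, φ, heP, hU, hφ, -, -, hnorm⟩ := h P hP
  have hderiv : ∀ x ∈ Metric.ball (0 : EuclideanSpace ℝ (Fin (n - 1))) r, ‖fderiv ℝ φ x‖ ≤ L := by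
    intro x hx
    have h1 : ENNReal.ofReal r * ‖fderiv ℝ φ x‖ₑ ≤ ENNReal.ofReal (L * r) := by
      refine le_trans ?_ hnorm
      unfold scaledC1Norm
      refine le_trans ?_ (le_self_add)
      refine le_trans ?_ (le_add_self)
      gcongr
      exact le_iSup₂ (f := fun x (_ : x ∈ Metric.ball (0 : EuclideanSpace ℝ (Fin (n - 1))) r) =>
        ‖fderiv ℝ φ x‖ₑ) x hx
    rw [← ofReal_norm, ← ENNReal.ofReal_mul hr.le,
      ENNReal.ofReal_le_ofReal_iff (by positivity)] at h1
    nlinarith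
  have hlip : ∀ a ∈ Metric.ball (0 : EuclideanSpace ℝ (Fin (n - 1))) r,
      ∀ b ∈ Metric.ball (0 : EuclideanSpace ℝ (Fin (n - 1))) r, φ b - φ a ≤ L * ‖b - a‖ := by
    intro a ha b hb
    refine (le_abs_self _).trans ?_
    exact (convex_ball _ r).norm_image_sub_le_of_norm_fderiv_le (𝕜 := ℝ)
      (fun x hx => (hφ.differentiableOn (by norm_num)).differentiableAt
        (Metric.isOpen_ball.mem_nhds hx)) hderiv ha hb
  have hball : ∀ z ∈ Metric.ball P r,
      (e z).fst ∈ Metric.ball (0 : EuclideanSpace ℝ (Fin (n - 1))) r := by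
    intro z hz
    rw [mem_ball_zero_iff]
    refine (WithLp.norm_fst_le _ (e z)).trans_lt ?_
    rw [← dist_zero_right, ← heP, e.dist_map]
    exact hz
  set ν := e.linearIsometryEquiv.symm (WithLp.toLp 2 (0, 1)) with hν
  have hmap : ∀ z u : EuclideanSpace ℝ (Fin n), ∀ t : ℝ,
      e (z + t • ν + u) = e z + t • WithLp.toLp 2 (0, 1) + e.linearIsometryEquiv u := by
    intro z u t
    have h1 : z + t • ν + u = (t • ν + u) +ᵥ z := by rw [vadd_eq_add]; abel
    rw [h1, e.map_vadd, vadd_eq_add, map_add, map_smul, hν, LinearIsometryEquiv.apply_symm_apply]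
    abel
  refine ⟨ν, ?_, ?_⟩
  · rw [hν, LinearIsometryEquiv.norm_map]
    simp
  · rintro z ⟨hzU, hzP⟩ t ht u hu hb
    have hz : φ (e z).fst < (e z).snd := by
      have : z ∈ U ∩ Metric.ball P r := ⟨hzU, hzP⟩
      rw [hU] at this
      exact this.2
    suffices h : z + t • ν + u ∈ U ∩ Metric.ball P r from h.1
    rw [hU]
    refine ⟨hb, ?_⟩
    have h1 := hlip _ (hball z hzP) _ (hball _ hb)
    rw [hmap] at h1 ⊢
    have hu1 : ‖(e.linearIsometryEquiv u).fst‖ ≤ ‖u‖ := by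
      rw [← e.linearIsometryEquiv.norm_map u]; exact WithLp.norm_fst_le _ _
    have hu2 : |(e.linearIsometryEquiv u).snd| ≤ ‖u‖ := by
      rw [← e.linearIsometryEquiv.norm_map u]; exact WithLp.norm_snd_le _ (e.linearIsometryEquiv u)
    simp only [WithLp.add_fst, WithLp.add_snd, WithLp.smul_fst, WithLp.smul_snd, WithLp.toLp_fst,
      WithLp.toLp_snd, smul_zero,
      add_zero, smul_eq_mul, mul_one, add_sub_cancel_left] at h1 ⊢
    -- The height gained is at least t - ‖u‖ and the graph rises by at most L‖u‖; this fixes the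
    -- opening 1/(1+L).
    have h2 : (1 + L) * ‖u‖ ≤ t := by
      calc (1 + L) * ‖u‖ ≤ (1 + L) * (1 / (1 + L) * t) := by gcongr
        _ = t := by field_simp
    have h3 := neg_abs_le (e.linearIsometryEquiv u).snd
    nlinarith

/-- A connected open set with a uniform cone condition and bounded volume has bounded diameter. -/
theorem exists_forall_dist_le_of_uniformCone {n : ℕ} (hn : 0 < n) {r η : ℝ} (hr : 0 < r)
    (hη₀ : 0 < η) (hη : η ≤ 1) (A : ℝ) :
    ∃ K : ℝ, 0 < K ∧ ∀ Ω : Set (EuclideanSpace ℝ (Fin n)), IsPreconnected Ω →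
      volume Ω ≤ ENNReal.ofReal A → UniformCone Ω r η → ∀ x ∈ Ω, ∀ y ∈ Ω, dist x y ≤ K := by
  have : Nonempty (Fin n) := ⟨⟨0, hn⟩⟩
  set s := r / 16 with hs
  have hs0 : 0 < s := by positivity
  have hηs : 0 < η * s := by positivity
  set m := volume (Metric.ball (0 : EuclideanSpace ℝ (Fin n)) (η * s)) with hm
  have hm0 : m ≠ 0 := (Metric.measure_ball_pos volume _ hηs).ne'
  have hmt : m ≠ ⊤ := measure_ball_lt_top.ne
  set C := (ENNReal.ofReal A / m).toReal with hC
  have hC0 : 0 ≤ C := ENNReal.toReal_nonneg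
  refine ⟨5 * s * (C + 1), by positivity, ?_⟩
  intro Ω hconn hvol hcone x hx y hy
  by_contra! hlt
  obtain ⟨f, hf⟩ := hcone.exists_continuous_pushDirections hr hη
  set N := ⌊dist x y / (5 * s)⌋₊ with hN
  -- By connectedness `Ω` meets every sphere about `x` of radius up to `dist x y`. Pushing each `w
  -- k` by s gives a ball of radius ηs in `Ω`; spacing 5s keeps centres 3s apart, so the balls are
  -- disjoint and the volume bounds their number.
  have hw : ∀ k : ℕ, k < N + 1 → ∃ w ∈ Ω, dist x w = k * (5 * s) := by
    intro k hk
    have himg := hconn.image (fun w => dist x w) (by fun_prop)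
    have h1 : (k : ℝ) * (5 * s) ∈ Set.Icc (dist x x) (dist x y) := by
      rw [dist_self]
      refine ⟨by positivity, ?_⟩
      have h2 : (k : ℝ) ≤ N := by exact_mod_cast Nat.lt_succ_iff.1 hk
      have h3 : (N : ℝ) ≤ dist x y / (5 * s) := Nat.floor_le (by positivity)
      rw [← le_div_iff₀ (by positivity)]
      exact h2.trans h3
    exact himg.Icc_subset ⟨x, hx, rfl⟩ ⟨y, hy, rfl⟩ h1
  choose! w hwΩ hwd using hw
  let c : ℕ → EuclideanSpace ℝ (Fin n) := fun k => w k + s • f (w k)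
  have hsub : ∀ k ∈ Finset.range (N + 1), Metric.ball (c k) (η * s) ⊆ Ω := fun k hk =>
    Metric.ball_subset_closedBall.trans (closedBall_subset_of_mem_pushDirections (hf _).1
      (hwΩ k (Finset.mem_range.1 hk)) hs0.le (by linarith))
  have hdisj : (↑(Finset.range (N + 1)) : Set ℕ).PairwiseDisjoint
      (fun k => Metric.ball (c k) (η * s)) := by
    intro i hi j hj hij
    have hi' := hwd i (Finset.mem_range.1 hi)
    have hj' := hwd j (Finset.mem_range.1 hj)
    refine Metric.ball_disjoint_ball ?_
    have h1 : 5 * s ≤ dist (w i) (w j) := by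
      have h2 : (1 : ℝ) ≤ |(i : ℝ) - j| := by
        have : (1 : ℤ) ≤ |(i : ℤ) - j| := Int.one_le_abs (sub_ne_zero.2 (by exact_mod_cast hij))
        exact_mod_cast this
      have h3 : |dist x (w i) - dist x (w j)| ≤ dist (w i) (w j) := by
        have := abs_dist_sub_le (w i) (w j) x
        rwa [dist_comm (w i) x, dist_comm (w j) x] at this
      rw [hi', hj', ← sub_mul, abs_mul, abs_of_pos (show 0 < 5 * s by positivity)] at h3
      nlinarith
    have h4 := dist_add_smul_le (x := w i) (hf (w i)).1.1 hs0.le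
    have h5 := dist_add_smul_le (x := w j) (hf (w j)).1.1 hs0.le
    have h7 := dist_triangle4 (w i) (c i) (c j) (w j)
    rw [dist_comm (w i) (c i)] at h7
    change dist (c i) (w i) ≤ s at h4
    change dist (c j) (w j) ≤ s at h5
    nlinarith
  have hle : ((N + 1 : ℕ) : ℝ≥0∞) * m ≤ ENNReal.ofReal A := by
    calc ((N + 1 : ℕ) : ℝ≥0∞) * m
        = ∑ k ∈ Finset.range (N + 1), volume (Metric.ball (c k) (η * s)) := by
          simp [hm, Measure.addHaar_ball_center]
      _ = volume (⋃ k ∈ Finset.range (N + 1), Metric.ball (c k) (η * s)) :=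
          (measure_biUnion_finset hdisj fun _ _ => measurableSet_ball).symm
      _ ≤ volume Ω := measure_mono (Set.iUnion₂_subset hsub)
      _ ≤ _ := hvol
  have hNC : ((N + 1 : ℕ) : ℝ) ≤ C := by
    have h1 : ((N + 1 : ℕ) : ℝ≥0∞) ≤ ENNReal.ofReal A / m :=
      (ENNReal.le_div_iff_mul_le (Or.inl hm0) (Or.inl hmt)).2 hle
    have h2 := ENNReal.toReal_mono (ENNReal.div_ne_top ENNReal.ofReal_ne_top hm0) h1
    rwa [ENNReal.toReal_natCast] at h2
  have h1 : dist x y / (5 * s) < N + 1 := Nat.lt_floor_add_one _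
  rw [div_lt_iff₀ (by positivity)] at h1
  push_cast at hNC
  nlinarith

/-! ### Crossing the boundary of the outer component. -/

section Inclusions

variable {n : ℕ} {Ω D D₁ D₂ G : Set (EuclideanSpace ℝ (Fin n))}

theorem IsOuterComponent.symm (h : IsOuterComponent Ω D₁ D₂ G) : IsOuterComponent Ω D₂ D₁ G := by
  unfold IsOuterComponent at h ⊢
  rwa [Set.union_comm]

theorem IsOuterComponent.subset (h : IsOuterComponent Ω D₁ D₂ G) : G ⊆ Ω \ (D₁ ∪ D₂) := by
  obtain ⟨⟨x, -, rfl⟩, -⟩ := h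
  exact connectedComponentIn_subset _ _

theorem IsOuterComponent.disjoint_closure (h : IsOuterComponent Ω D₁ D₂ G) (hD₁ : IsOpen D₁) :
    Disjoint D₁ (closure G) :=
  (Set.disjoint_left.2 fun _ hx hG => (h.subset hG).2 (Or.inl hx)).closure_right hD₁

/-- A point of the boundary of `G` in `Ω` away from `D₂` lies on the boundary of `D₁`. -/
theorem IsOuterComponent.mem_frontier_inter (h : IsOuterComponent Ω D₁ D₂ G) (hΩ : IsOpen Ω)
    (hD₁ : IsOpen D₁) (hD₁Ω : D₁ ⊆ Ω) {z : EuclideanSpace ℝ (Fin n)} (hz : z ∈ Ω)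
    (hzG : z ∈ frontier G) (hz₂ : z ∉ closure D₂) :
    z ∈ frontier D₁ ∩ frontier (Ω \ closure G) := by
  have hdisj := h.disjoint_closure hD₁
  -- Otherwise a ball about `z` avoids both inclusions and meets `G`, so it lies in that component,
  -- and `z` is interior to `G`.
  have hz₁ : z ∈ closure D₁ := by
    by_contra hz₁
    have hopen : IsOpen (Ω ∩ (closure D₁)ᶜ ∩ (closure D₂)ᶜ) :=
      (hΩ.inter isClosed_closure.isOpen_compl).inter isClosed_closure.isOpen_compl
    obtain ⟨ε, hε, hsub⟩ := Metric.isOpen_iff.1 hopen z ⟨⟨hz, hz₁⟩, hz₂⟩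
    obtain ⟨g, hg, hzg⟩ := Metric.mem_closure_iff.1 hzG.1 ε hε
    refine hzG.2 (mem_interior.2 ⟨Metric.ball z ε, ?_, Metric.isOpen_ball, Metric.mem_ball_self hε⟩)
    obtain ⟨⟨x, -, rfl⟩, -⟩ := h
    rw [connectedComponentIn_eq hg]
    refine (convex_ball z ε).isPreconnected.subset_connectedComponentIn
      (by rwa [Metric.mem_ball, dist_comm]) fun w hw => ⟨(hsub hw).1.1, ?_⟩
    rintro (hw' | hw')
    · exact (hsub hw).1.2 (subset_closure hw')
    · exact (hsub hw).2 (subset_closure hw')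
  refine ⟨⟨hz₁, fun hi => Set.disjoint_left.1 hdisj (interior_subset hi) hzG.1⟩, ?_, ?_⟩
  · have hsub : D₁ ⊆ Ω \ closure G := fun w hw => ⟨hD₁Ω hw, Set.disjoint_left.1 hdisj hw⟩
    exact closure_mono hsub hz₁
  · exact fun hi => (interior_subset hi).2 hzG.1

theorem IsInclusion.closure_subset {r δ L α : ℝ} (h : IsInclusion r δ L α Ω D) (hδ : 0 < δ)
    (hΩ : IsOpen Ω) : closure D ⊆ Ω := by
  intro x hx
  by_contra hxΩ
  have hxf : x ∈ frontier Ω := by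
    rw [hΩ.frontier_eq]
    exact ⟨closure_mono h.subset hx, hxΩ⟩
  obtain ⟨w, hw, hd⟩ := Metric.mem_closure_iff.1 hx δ hδ
  have := h.le_dist w hw x hxf
  rw [dist_comm] at this
  linarith

/-- A point of `Ω` at distance at least `h` from `D₂` that is not interior to `G` forces the
modified distance to be at least a multiple of `h`. -/
theorem IsOuterComponent.le_modifiedDist (hn : 0 < n) {r r' M δ L α η h : ℝ}
    (hG : IsOuterComponent Ω D₁ D₂ G) (hΩ : IsConductor r M L α Ω)
    (h₁ : IsInclusion r δ L α Ω D₁) (h₂ : IsInclusion r δ L α Ω D₂)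
    (hcone : UniformCone D₂ᶜ r' η) (hη₀ : 0 < η) (hη : η ≤ 1) (hr' : 0 < r') (hr'δ : r' ≤ δ)
    (hh₀ : 0 < h) (hh : h < r' / 4) {y : EuclideanSpace ℝ (Fin n)} (hy : y ∈ Ω)
    (hyG : y ∉ interior G) (hyD : ∀ w ∈ D₂, h ≤ dist y w) :
    ENNReal.ofReal (η * (h / 2)) ≤ modifiedDist Ω G D₁ D₂ := by
  have : Nonempty (Fin n) := ⟨⟨0, hn⟩⟩
  have hδ : 0 < δ := hr'.trans_le hr'δ
  obtain ⟨Q, hQ⟩ : (frontier Ω).Nonempty := nonempty_frontier_iff.2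
    ⟨⟨y, hy⟩, fun hu => NormedSpace.unbounded_univ ℝ (EuclideanSpace ℝ (Fin n)) (hu ▸ hΩ.isBounded)⟩
  obtain ⟨g, hg, hgQ⟩ := Metric.mem_closure_iff.1 (hG.2 hQ).1 (δ / 2) (by linarith)
  rw [dist_comm] at hgQ
  have hgD : g ∉ closure D₂ := by
    intro hc
    obtain ⟨w, hw, hd⟩ := Metric.mem_closure_iff.1 hc (δ / 2) (by linarith)
    have := dist_triangle_left w Q g
    linarith [h₂.le_dist w hw Q hQ]
  obtain ⟨S, hS, hyS, hgS, hSΩ, hSD⟩ := hcone.exists_isPreconnected hη hr' hr'δ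
    h₂.isConnected_diff.isPreconnected h₂.le_dist hh₀ hh hy hyD ⟨(hG.subset hg).1, hgD⟩
    ⟨Q, hQ, hgQ⟩
  obtain ⟨z, hzS, hzG⟩ : (S ∩ frontier G).Nonempty := by
    by_contra hne
    rw [← Set.not_disjoint_iff_nonempty_inter, not_not] at hne
    exact hyG (hS.subset_interior_of_disjoint_frontier hgS hg hne hyS)
  have hpos : 0 < η * (h / 2) := by positivity
  have hzD : z ∉ closure D₂ := by
    intro hc
    obtain ⟨w, hw, hd⟩ := Metric.mem_closure_iff.1 hc _ hpos
    linarith [hSD z hzS w hw]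
  have hz := hG.mem_frontier_inter hΩ.isOpen h₁.isOpen h₁.subset (hSΩ hzS) hzG hzD
  refine le_trans ?_ (le_max_left _ _)
  refine le_trans ?_ (le_iSup₂ (f := fun x (_ : x ∈ frontier D₁ ∩ frontier (Ω \ closure G)) =>
    Metric.infEDist x D₂) z hz)
  refine Metric.le_infEDist.2 fun w hw => ?_
  rw [edist_dist]
  exact ENNReal.ofReal_le_ofReal (hSD z hzS w hw)

theorem modifiedDist_comm : modifiedDist Ω G D₁ D₂ = modifiedDist Ω G D₂ D₁ :=
  max_comm _ _

theorem IsInclusion.frontier_nonempty (hn : 0 < n) {r δ L α : ℝ} (h : IsInclusion r δ L α Ω D) :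
    (frontier D).Nonempty := by
  have : Nonempty (Fin n) := ⟨⟨0, hn⟩⟩
  exact nonempty_frontier_iff.2 ⟨h.nonempty, fun hu =>
    NormedSpace.unbounded_univ ℝ (EuclideanSpace ℝ (Fin n)) (hu ▸ h.isBounded)⟩

/-- The one-sided local estimate: boundary points of `D₁` at distance `h` from `∂D₂`. -/
theorem IsOuterComponent.le_modifiedDist_of_mem_frontier (hn : 0 < n) {r r' M δ L α η h : ℝ}
    (hG : IsOuterComponent Ω D₁ D₂ G) (hΩ : IsConductor r M L α Ω)
    (h₁ : IsInclusion r δ L α Ω D₁) (h₂ : IsInclusion r δ L α Ω D₂)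
    (hcone₁ : UniformCone D₁ᶜ r' η) (hcone₂ : UniformCone D₂ᶜ r' η)
    (hη₀ : 0 < η) (hη : η ≤ 1) (hr' : 0 < r') (hr'δ : r' ≤ δ)
    (hh₀ : 0 < h) (hh : h < r' / 4) {x : EuclideanSpace ℝ (Fin n)} (hx : x ∈ frontier D₁)
    (hxD : ∀ w ∈ frontier D₂, h ≤ dist x w) :
    ENNReal.ofReal (η ^ 2 / 4 * h) ≤ modifiedDist Ω G D₁ D₂ := by
  have hδ : 0 < δ := hr'.trans_le hr'δ
  have hdisj : Disjoint (Metric.ball x h) (frontier D₂) := Set.disjoint_left.2 fun w hw hw' => by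
    rw [Metric.mem_ball, dist_comm] at hw
    linarith [hxD w hw']
  have hball := (convex_ball x h).isPreconnected
  -- Inside `D₂`, pushing `x` by h/2 out of `D₁` stays in `D₂`, hence outside `G`, and is ηh/2 away
  -- from `D₁`. Applying the crossing estimate with exchanged roles to that distance gives the
  -- second factor η/2.
  by_cases hx₂ : x ∈ D₂
  · have hsub := hball.subset_interior_of_disjoint_frontier (Metric.mem_ball_self hh₀) hx₂ hdisj
    obtain ⟨f, hf⟩ := hcone₁.exists_continuous_pushDirections hr' hη
    have hx₁ : x ∈ D₁ᶜ := fun hxD₁ => hx.2 (by rwa [h₁.isOpen.interior_eq])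
    have hpush := closedBall_subset_of_mem_pushDirections (hf x).1 hx₁
      (show 0 ≤ h / 2 by linarith) (by linarith)
    have hy₂ : x + (h / 2) • f x ∈ D₂ := interior_subset (hsub (by
      rw [Metric.mem_ball]
      linarith [dist_add_smul_le (x := x) (hf x).1.1 (show 0 ≤ h / 2 by linarith)]))
    have hle := hG.symm.le_modifiedDist hn hΩ h₂ h₁ hcone₁ hη₀ hη hr' hr'δ
      (h := η * (h / 2)) (by positivity) (by nlinarith) (h₂.subset hy₂)
      (fun hi => (hG.subset (interior_subset hi)).2 (Or.inr hy₂)) (fun w hw => by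
        by_contra! hlt
        exact hpush (by rw [Metric.mem_closedBall, dist_comm]; exact hlt.le) hw)
    rw [modifiedDist_comm]
    convert hle using 2
    ring
  · have hsub := hball.subset_interior_of_disjoint_frontier (A := D₂ᶜ) (Metric.mem_ball_self hh₀)
      hx₂ (by rwa [frontier_compl])
    refine le_trans (ENNReal.ofReal_le_ofReal ?_) (hG.le_modifiedDist hn hΩ h₁ h₂ hcone₂ hη₀ hη hr'
      hr'δ hh₀ hh (h₁.closure_subset hδ hΩ.isOpen hx.1) ?_ ?_)
    · have : η ^ 2 ≤ η := by nlinarith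
      nlinarith
    · intro hi
      obtain ⟨w, hwG, hwD⟩ := mem_closure_iff.1 hx.1 _ isOpen_interior hi
      exact (hG.subset (interior_subset hwG)).2 (Or.inl hwD)
    · intro w hw
      by_contra! hlt
      exact interior_subset (hsub (by rwa [Metric.mem_ball, dist_comm])) hw

theorem IsOuterComponent.infEDist_frontier_le (hn : 0 < n) {r r' M δ L α η K : ℝ}
    (hG : IsOuterComponent Ω D₁ D₂ G) (hΩ : IsConductor r M L α Ω)
    (h₁ : IsInclusion r δ L α Ω D₁) (h₂ : IsInclusion r δ L α Ω D₂)
    (hcone₁ : UniformCone D₁ᶜ r' η) (hcone₂ : UniformCone D₂ᶜ r' η)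
    (hη₀ : 0 < η) (hη : η ≤ 1) (hr' : 0 < r') (hr'δ : r' ≤ δ) (hK₀ : 0 < K)
    (hK : ∀ x ∈ Ω, ∀ y ∈ Ω, dist x y ≤ K) {x : EuclideanSpace ℝ (Fin n)} (hx : x ∈ frontier D₁) :
    Metric.infEDist x (frontier D₂) ≤
      ENNReal.ofReal ((1 + 8 * K / r') * (4 / η ^ 2)) * modifiedDist Ω G D₁ D₂ := by
  have hδ : 0 < δ := hr'.trans_le hr'δ
  have hne := h₂.frontier_nonempty hn
  have hfin : Metric.infEDist x (frontier D₂) ≠ ⊤ := Metric.infEDist_ne_top hne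
  rw [← ENNReal.ofReal_toReal hfin]
  set d := (Metric.infEDist x (frontier D₂)).toReal with hd
  rcases (ENNReal.toReal_nonneg : 0 ≤ d).eq_or_lt with h0 | h0
  · rw [hd, ← h0]; simp
  have hdle : ∀ w ∈ frontier D₂, d ≤ dist x w := fun w hw => Metric.infDist_le_dist_of_mem hw
  have hdK : d ≤ K := by
    obtain ⟨q, hq⟩ := hne
    exact (hdle q hq).trans (hK x (h₁.closure_subset hδ hΩ.isOpen hx.1) q
      (h₂.closure_subset hδ hΩ.isOpen hq.1))
  -- The local estimate needs h < r'/4, so d is truncated at r'/8; the factor 1 + 8K/r' makes up for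
  -- it because d ≤ K.
  have hmin : 0 < min d (r' / 8) := lt_min h0 (by positivity)
  have hle := hG.le_modifiedDist_of_mem_frontier hn hΩ h₁ h₂ hcone₁ hcone₂ hη₀ hη hr' hr'δ hmin
    ((min_le_right _ _).trans_lt (by linarith)) hx
    (fun w hw => (min_le_left _ _).trans (hdle w hw))
  refine le_trans ?_ (mul_le_mul_right hle _)
  rw [← ENNReal.ofReal_mul (by positivity)]
  refine ENNReal.ofReal_le_ofReal ?_
  have e : (1 + 8 * K / r') * (4 / η ^ 2) * (η ^ 2 / 4 * min d (r' / 8)) =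
      (1 + 8 * K / r') * min d (r' / 8) := by field_simp
  rw [e]
  rcases min_choice d (r' / 8) with hm | hm
  · rw [hm]
    have : 0 ≤ 8 * K / r' := by positivity
    nlinarith
  · rw [hm]
    have : (1 + 8 * K / r') * (r' / 8) = r' / 8 + K := by field_simp
    linarith

end Inclusions

/-! ### The global estimate, at the common scale min(r, δ). -/

theorem proposition3p1 (n : ℕ) (hn : 2 ≤ n) (r M δ L α : ℝ) (hr : 0 < r) (hM : 0 < M)
    (hδ : 0 < δ) (hL : 0 < L) (hα₀ : 0 < α) (hα₁ : α < 1) :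
    ∃ c : ℝ, 0 < c ∧
      ∀ Ω D₁ D₂ G : Set (EuclideanSpace ℝ (Fin n)),
        IsConductor r M L α Ω →
        IsInclusion r δ L α Ω D₁ →
        IsInclusion r δ L α Ω D₂ →
        IsOuterComponent Ω D₁ D₂ G →
        Metric.hausdorffEDist (frontier D₁) (frontier D₂)
          ≤ ENNReal.ofReal c * modifiedDist Ω G D₁ D₂ := by
  have hn₀ : 0 < n := by omega
  have hη₀ : 0 < 1 / (1 + L) := by positivity
  have hη : 1 / (1 + L) ≤ 1 := by
    rw [div_le_one (by positivity)]; linarith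
  obtain ⟨K, hK₀, hK⟩ := exists_forall_dist_le_of_uniformCone hn₀ hr hη₀ hη (M * r ^ n)
  have hr' : 0 < min r δ := lt_min hr hδ
  refine ⟨(1 + 8 * K / min r δ) * (4 / (1 / (1 + L)) ^ 2), by positivity, ?_⟩
  intro Ω D₁ D₂ G hΩ h₁ h₂ hG
  have hdiam := hK Ω hΩ.isConnected.isPreconnected hΩ.volume_le (hΩ.boundary.uniformCone hr hL)
  have hc₁ := (h₁.boundary.uniformCone hr hL).compl.mono (min_le_left r δ)
  have hc₂ := (h₂.boundary.uniformCone hr hL).compl.mono (min_le_left r δ)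
  refine Metric.hausdorffEDist_le_of_infEDist (fun x hx => ?_) (fun x hx => ?_)
  · exact hG.infEDist_frontier_le hn₀ hΩ h₁ h₂ hc₁ hc₂ hη₀ hη hr' (min_le_right _ _) hK₀ hdiam hx
  · rw [modifiedDist_comm]
    exact hG.symm.infEDist_frontier_le hn₀ hΩ h₂ h₁ hc₂ hc₁ hη₀ hη hr' (min_le_right _ _) hK₀
      hdiam hx
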